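/- Let $q$ be a power of a prime, $K=\mathbb{F}_q(\theta)$, with the absolute value $|a|=q^{\deg_\theta a}$. Let $K_\infty=\mathbb{F}_q((1/\theta))$ be the completion of $K$, and let $C$ be the completion of an algebraic closure of $K_\infty$ for the unique extension of $|\cdot|$. Let $K^{\mathrm{alg}}\subset C$ be the set of elements of $C$ that are algebraic over $K$. (1) Let $\alpha\in K^{\mathrm{alg}}$ satisfy $0<|\alpha|<1$ and $\alpha^{q^n}\neq\theta^{-1}$ for all $n\geq 1$. Then the product $$f_{\mathrm{De}}(\alpha)=\prod_{n\geq 1}\bigl(1-\theta\alpha^{q^n}\bigr)$$ converges in $C$ and its value is transcendental over $K$. (If $\alpha^{q^n}=\theta^{-1}$ for some $n\geq1$, then $f_{\mathrm{De}}(\alpha)=0$.) (2) Consequently the fundamental period of the Carlitz module, $$\widetilde\pi=\theta\,(-\theta)^{1/(q-1)}\prod_{i\geq 1}\bigl(1-\theta^{1-q^i}\bigr)^{-1},$$ is transcendental over $K$, for every choice of the root $(-\theta)^{1/(q-1)}$ in $C$; the product converges in $C$. -/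

import Mathlib

noncomputable section

namespace Carlitz

open UniformSpace
open scoped NNReal

/-- `K_∞`, the completion of `K = F(θ)` (Mathlib's `RatFunc F`, with `θ = RatFunc.X`) for the
place at infinity, i.e. for the valuation attached to the degree in `θ`. -/
abbrev KInfty (F : Type*) [Field F] : Type _ :=
  @RatFunc.CompletionAtInfty F _ (Classical.decEq _)

section

variable (F : Type*) [Field F]

instance : CompleteSpace (KInfty F) :=
  letI : DecidableEq (RatFunc F) := Classical.decEq _
  letI : UniformSpace (RatFunc F) := (RatFunc.inftyValued F).toUniformSpace
  inferInstanceAs (CompleteSpace (Completion (RatFunc F)))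

/-- The valuation of `K_∞` restricts to the place at infinity of `K`. -/
theorem valuation_algebraMap (x : RatFunc F) :
    Valued.v (algebraMap (RatFunc F) (KInfty F) x) =
      @RatFunc.inftyValuation F _ (Classical.decEq _) x :=
  letI : DecidableEq (RatFunc F) := Classical.decEq _
  letI : Valued (RatFunc F) (WithZero (Multiplicative ℤ)) := RatFunc.inftyValued F
  Valued.extensionValuation_apply_coe (K := RatFunc F) x

variable [Finite F]

theorem one_lt_card : (1 : ℝ≥0) < (Nat.card F : ℝ≥0) := by
  exact_mod_cast Finite.one_lt_card (α := F)

/-- The valuation of `K_∞` takes values in `{0} ∪ q ^ ℤ`, where `q = #F`: the element `exp n` of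
the value group is sent to the real number `q ^ n`. -/
instance rankOneKInfty : (Valued.v : Valuation (KInfty F) (WithZero (Multiplicative ℤ))).RankOne where
  hom' := (WithZeroMulInt.toNNReal (one_lt_card F).ne_zero).comp
    MonoidWithZeroHom.ValueGroup₀.embedding
  strictMono' := (WithZeroMulInt.toNNReal_strictMono (one_lt_card F)).comp
    MonoidWithZeroHom.ValueGroup₀.embedding_strictMono
  exists_val_nontrivial :=
    ⟨algebraMap (RatFunc F) (KInfty F) RatFunc.X, by
      rw [valuation_algebraMap, RatFunc.inftyValuation.X]
      exact ⟨WithZero.coe_ne_zero, by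
        rw [← WithZero.exp_zero, Ne, WithZero.exp_inj]; exact one_ne_zero⟩⟩

/-- The absolute value of `K_∞`, normalised by `|θ| = q = #F`. -/
instance : NontriviallyNormedField (KInfty F) :=
  Valued.toNontriviallyNormedField (KInfty F) (WithZero (Multiplicative ℤ))

instance : IsUltrametricDist (KInfty F) :=
  inferInstanceAs (@IsUltrametricDist (KInfty F)
    (Valued.toNormedField (KInfty F) (WithZero (Multiplicative ℤ))).toDist)

/-- The normalisation of the absolute value: `|a| = q ^ deg a` for nonzero `a` in `K`. -/
theorem norm_algebraMap {a : RatFunc F} (ha : a ≠ 0) :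
    ‖algebraMap (RatFunc F) (KInfty F) a‖ = (Nat.card F : ℝ) ^ a.intDegree := by
  let : DecidableEq (RatFunc F) := Classical.decEq _
  change ((WithZeroMulInt.toNNReal (one_lt_card F).ne_zero
    (MonoidWithZeroHom.ValueGroup₀.embedding (Valued.v.restrict _)) : ℝ≥0) : ℝ) = _
  rw [Valuation.embedding_restrict, valuation_algebraMap, RatFunc.inftyValuation_apply,
    RatFunc.inftyValuation_of_nonzero F ha,
    WithZeroMulInt.toNNReal_neg_apply _ WithZero.exp_ne_zero]
  simp [WithZero.exp]

end

/-- `K_∞^alg`, a fixed algebraic closure of `K_∞`. -/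
abbrev KInftyAlg (F : Type*) [Field F] : Type _ := AlgebraicClosure (KInfty F)

section

variable (F : Type*) [Field F] [Finite F]

/-- The unique extension of the absolute value of `K_∞` to its algebraic closure. -/
instance : NormedField (KInftyAlg F) := spectralNorm.normedField (KInfty F) (KInftyAlg F)

instance : NormedAlgebra (KInfty F) (KInftyAlg F) := spectralNorm.normedAlgebra _ _

end

/-- The field `C`: the completion of `K_∞^alg`, with the extended absolute value `‖·‖`. -/
abbrev CInfty (F : Type*) [Field F] [Finite F] : Type _ := Completion (KInftyAlg F)

section

variable (F : Type*) [Field F] [Finite F]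

instance : NormedField (CInfty F) := inferInstance

/-- The inclusions `K ⊆ K_∞ ⊆ K_∞^alg ⊆ C`. -/
instance : Algebra (RatFunc F) (CInfty F) :=
  ((algebraMap (KInftyAlg F) (CInfty F)).comp
    ((algebraMap (KInfty F) (KInftyAlg F)).comp (algebraMap (RatFunc F) (KInfty F)))).toAlgebra

/-- The element `θ` of `C`. -/
def theta : CInfty F := algebraMap (RatFunc F) (CInfty F) RatFunc.X

theorem norm_theta : ‖theta F‖ = Nat.card F := by
  change ‖((algebraMap (KInfty F) (KInftyAlg F) (algebraMap (RatFunc F) (KInfty F) RatFunc.X) :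
    KInftyAlg F) : CInfty F)‖ = _
  rw [Completion.norm_coe, norm_algebraMap', norm_algebraMap F RatFunc.X_ne_zero,
    RatFunc.intDegree_X, zpow_one]

/-- `C` contains the `(q - 1)`-st roots of `-θ`. -/
theorem exists_pow_eq_neg_theta : ∃ l : CInfty F, l ^ (Nat.card F - 1) = -theta F := by
  obtain ⟨z, hz⟩ := IsAlgClosed.exists_pow_nat_eq
    (-algebraMap (KInfty F) (KInftyAlg F) (algebraMap (RatFunc F) (KInfty F) RatFunc.X))
    (Nat.sub_pos_of_lt (Finite.one_lt_card (α := F)))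
  refine ⟨algebraMap (KInftyAlg F) (CInfty F) z, ?_⟩
  rw [← map_pow, hz, map_neg]
  rfl

/-- The `n`-th factor (`n ≥ 0`) of the product `∏_{n ≥ 1} (1 - θ x ^ (q ^ n))`, where `q = #F`,
shifted so that the product starts with `n = 0`. -/
def fDeFactor (x : CInfty F) (n : ℕ) : CInfty F :=
  1 - theta F * x ^ (Nat.card F ^ (n + 1))

/-- `f_De(x) = ∏_{n ≥ 1} (1 - θ x ^ (q ^ n))`. -/
def fDe (x : CInfty F) : CInfty F := ∏' n : ℕ, fDeFactor F x n

/-- The `i`-th factor (`i ≥ 0`) of the product `∏_{i ≥ 1} (1 - θ ^ (1 - q ^ i))⁻¹`,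
shifted so that the product starts with `i = 0`. -/
def periodFactor (i : ℕ) : CInfty F :=
  (1 - theta F ^ (1 - (Nat.card F : ℤ) ^ (i + 1)))⁻¹

/-- The period `θ l ∏_{i ≥ 1} (1 - θ ^ (1 - q ^ i))⁻¹` of the Carlitz module, to be used with a
choice `l` of a root `(-θ) ^ (1 / (q - 1))`, i.e. with `l ^ (q - 1) = -θ`. -/
def period (l : CInfty F) : CInfty F := theta F * l * ∏' i : ℕ, periodFactor F i

end

end Carlitz

end

/-! Mahler's method. The function f(x) = ∏_{n ≥ 1} (1 - θ x^(q^n)) satisfies f(x) = (1 - θ x^q)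
f(x^q), so if α and β = f(α) were both algebraic, every f(α^(q^k)) would be algebraic of controlled
size. Linear algebra gives P ≠ 0, of degree at most N in x and in y, with P(x, f(x)) vanishing to
order at least N² at 0. Put Pr_k = ∏_{1 ≤ n ≤ k} (1 - θ α^(q^n)). Then Pr_k^N P(α^(q^k), f(α^(q^k)))
is a polynomial in α and β over F[θ]; Liouville's inequality (`HasSize.exists_one_le`) bounds it
below by a constant times B^(-5N q^k) if it is nonzero, while the vanishing bounds it above by a
constant times |α|^(N² q^k). For N large and k → ∞ these are incompatible.

Nonvanishing rests on f not being algebraic (`exists_not_X_pow_dvd_eval_partialProd`): f has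
infinitely many zeros in the open unit disc, and in a relation P(x, f(x)) = 0 freed of factors y the
term P(x, 0) would vanish at all of them. Power series are replaced by the partial products p_m,
which agree with f modulo x^(q^(m+1)).

The period is θ l / f(1/θ), hence transcendental as well. In `F[X][X][X]` the variables, from the
inside out, are θ, x and y. -/

namespace Carlitz

open Polynomial Matrix

/-! ### Sizes and Liouville's inequality -/

section Liouville

variable {F : Type*} [Field F] {Ω : Type*} [NormedField Ω] [Algebra F[X] Ω]

/-- `γ` has size at most `n` with respect to the vector `v`, the denominator `D` and the constant
`c`: multiplication by `D ^ n * γ` acts on `v` through a matrix over `F[X]` whose entries have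
degree at most `c * n`. -/
def HasSize {d : ℕ} (v : Fin d → Ω) (D : F[X]) (c n : ℕ) (γ : Ω) : Prop :=
  ∃ M : Matrix (Fin d) (Fin d) F[X],
    M.map (algebraMap F[X] Ω) *ᵥ v = (algebraMap F[X] Ω D ^ n * γ) • v ∧
      ∀ i j, (M i j).natDegree ≤ c * n

variable {d : ℕ} {v : Fin d → Ω} {D : F[X]} {c : ℕ}

theorem HasSize.mono {m n : ℕ} {γ : Ω} (h : HasSize v D c m γ) (hD : D.natDegree ≤ c)
    (hmn : m ≤ n) : HasSize v D c n γ := by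
  obtain ⟨M, hM, hdeg⟩ := h
  obtain ⟨k, rfl⟩ := Nat.exists_eq_add_of_le hmn
  refine ⟨D ^ k • M, ?_, fun i j => ?_⟩
  · have : (D ^ k • M).map (algebraMap F[X] Ω) =
        (algebraMap F[X] Ω D ^ k) • M.map (algebraMap F[X] Ω) := by
      ext i j; simp
    rw [this, smul_mulVec, hM, smul_smul]
    congr 1
    ring
  · rw [Matrix.smul_apply, smul_eq_mul]
    refine natDegree_mul_le.trans ?_
    have h1 : (D ^ k).natDegree ≤ k * c := natDegree_pow_le.trans (Nat.mul_le_mul_left _ hD)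
    have h2 := hdeg i j
    rw [mul_add, mul_comm c k]
    omega

theorem HasSize.add {n : ℕ} {γ δ : Ω} (hγ : HasSize v D c n γ) (hδ : HasSize v D c n δ) :
    HasSize v D c n (γ + δ) := by
  obtain ⟨M, hM, hMd⟩ := hγ
  obtain ⟨M', hM', hMd'⟩ := hδ
  refine ⟨M + M', ?_, fun i j => natDegree_add_le_of_degree_le (hMd i j) (hMd' i j)⟩
  rw [Matrix.map_add _ (map_add _), add_mulVec, hM, hM', ← add_smul, mul_add]

theorem HasSize.mul {m n : ℕ} {γ δ : Ω} (hγ : HasSize v D c m γ) (hδ : HasSize v D c n δ) :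
    HasSize v D c (m + n) (γ * δ) := by
  obtain ⟨M, hM, hMd⟩ := hγ
  obtain ⟨M', hM', hMd'⟩ := hδ
  refine ⟨M * M', ?_, fun i j => ?_⟩
  · rw [Matrix.map_mul, ← mulVec_mulVec, hM', mulVec_smul, hM, smul_smul]
    congr 1
    ring
  · rw [Matrix.mul_apply, mul_add]
    exact natDegree_sum_le_of_forall_le _ _ fun k _ =>
      natDegree_mul_le.trans (Nat.add_le_add (hMd i k) (hMd' k j))

/-- The scalar matrix D ^ n * a has entries of degree at most n (deg D + 1); hence the extra 1
required of c. -/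
theorem hasSize_algebraMap {n : ℕ} {a : F[X]} (hD : D.natDegree + 1 ≤ c) (ha : a.natDegree ≤ n) :
    HasSize v D c n (algebraMap F[X] Ω a) := by
  refine ⟨Matrix.scalar _ (D ^ n * a), ?_, fun i j => ?_⟩
  · ext i
    simp [Matrix.mulVec, dotProduct, Matrix.diagonal_apply, apply_ite, ite_mul]
  · have h1 : (D ^ n * a).natDegree ≤ c * n := by
      refine natDegree_mul_le.trans ?_
      have h1 : (D ^ n).natDegree ≤ n * D.natDegree := natDegree_pow_le
      nlinarith
    by_cases hij : i = j
    · simpa [Matrix.diagonal_apply, hij] using h1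
    · simp [hij]

theorem HasSize.pow {n : ℕ} {γ : Ω} (hD : D.natDegree + 1 ≤ c) (hγ : HasSize v D c n γ) (k : ℕ) :
    HasSize v D c (k * n) (γ ^ k) := by
  induction k with
  | zero => simpa using hasSize_algebraMap (v := v) (n := 0) (a := (1 : F[X])) hD (by simp)
  | succ k ih =>
    rw [pow_succ, Nat.succ_mul]
    exact ih.mul hγ

theorem HasSize.sum {κ : Type*} {n : ℕ} {γ : κ → Ω} (hD : D.natDegree + 1 ≤ c) (s : Finset κ)
    (h : ∀ i ∈ s, HasSize v D c n (γ i)) : HasSize v D c n (∑ i ∈ s, γ i) := by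
  classical
  induction s using Finset.induction_on with
  | empty => simpa using hasSize_algebraMap (v := v) (n := n) (a := (0 : F[X])) hD (by simp)
  | insert a s ha ih =>
    rw [Finset.sum_insert ha]
    exact (h a (by simp)).add (ih fun i hi => h i (by simp [hi]))

/-- Liouville's inequality. -/
theorem HasSize.exists_one_le {b : ℝ} (hb : 1 ≤ b)
    (hle : ∀ a : F[X], ‖algebraMap F[X] Ω a‖ ≤ b ^ a.natDegree)
    (hge : ∀ a : F[X], a ≠ 0 → 1 ≤ ‖algebraMap F[X] Ω a‖)
    (hv : LinearIndependent F[X] v) (hd : 0 < d) (D : F[X]) (c : ℕ) :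
    ∃ B : ℝ, 1 ≤ B ∧ ∀ (n : ℕ) (γ : Ω), γ ≠ 0 → D ≠ 0 → HasSize v D c n γ →
      1 ≤ B ^ (n + 1) * ‖γ‖ := by
  have hinj : ∀ a : F[X], algebraMap F[X] Ω a = 0 → a = 0 := fun a ha => by
    by_contra h
    have := hge a h
    rw [ha, norm_zero] at this
    linarith
  let i₀ : Fin d := ⟨0, hd⟩
  have hv0 : 0 < ‖v i₀‖ := norm_pos_iff.2 (hv.ne_zero i₀)
  obtain ⟨V, hV1, hV⟩ : ∃ V : ℝ, 1 ≤ V ∧ ∀ i, ‖v i‖ ≤ V :=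
    ⟨1 + ∑ i, ‖v i‖, by simpa using Finset.sum_nonneg fun i _ => norm_nonneg (v i), fun i => by
      have := Finset.single_le_sum (fun i _ => norm_nonneg (v i)) (Finset.mem_univ i)
      linarith⟩
  set D' := ‖algebraMap F[X] Ω D‖
  -- `B₁` collects the factors raised to the power n, `B₂` those independent of n.
  set B₁ : ℝ := D' * b ^ (c * d)
  set B₂ : ℝ := d.factorial * V ^ d / ‖v i₀‖
  have hB₁ : 0 ≤ B₁ := by positivity
  have hB₂ : 0 ≤ B₂ := by positivity
  refine ⟨max 1 (max B₁ B₂), le_max_left _ _, ?_⟩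
  rintro n γ hγ hD0 ⟨M, hM, hdeg⟩
  set δ := algebraMap F[X] Ω D ^ n * γ
  have hδ : δ ≠ 0 := mul_ne_zero (pow_ne_zero _ fun h => hD0 (hinj _ h)) hγ
  -- A left kernel vector w of M would give δ (w · v) = w · M v = 0, contradicting the independence
  -- of v.
  have hdet : M.det ≠ 0 := by
    intro h0
    obtain ⟨w, hw, hwM⟩ := exists_vecMul_eq_zero_iff.2 h0
    apply hw
    have h1 : (algebraMap F[X] Ω ∘ w) ⬝ᵥ (M.map (algebraMap F[X] Ω) *ᵥ v) = 0 := by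
      rw [dotProduct_mulVec]
      have : (algebraMap F[X] Ω ∘ w) ᵥ* M.map (algebraMap F[X] Ω) = 0 := by
        ext i
        have := congrArg (algebraMap F[X] Ω) (congrFun hwM i)
        rw [RingHom.map_vecMul] at this
        simpa using this
      rw [this, zero_dotProduct]
    rw [hM, dotProduct_smul, smul_eq_mul, mul_eq_zero, or_iff_right hδ] at h1
    funext i
    refine Fintype.linearIndependent_iff.1 hv w ?_ i
    simpa [dotProduct, Algebra.smul_def] using h1
  -- Cramer's rule for M v = δ v: the determinant of M, a nonzero element of F[θ] and so of norm at
  -- least 1, is compared with δ, without conjugates or separability.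
  have hcr : algebraMap F[X] Ω M.det * v i₀ =
      δ * ((M.map (algebraMap F[X] Ω)).updateCol i₀ v).det := by
    have h1 := cramer_eq_adjugate_mulVec (M.map (algebraMap F[X] Ω))
      (M.map (algebraMap F[X] Ω) *ᵥ v)
    rw [mulVec_mulVec, adjugate_mul, smul_mulVec, one_mulVec, hM] at h1
    have h2 := congrFun h1 i₀
    rw [cramer_apply, det_updateCol_smul] at h2
    rw [RingHom.map_det]
    exact h2.symm
  have hdetle : ‖((M.map (algebraMap F[X] Ω)).updateCol i₀ v).det‖ ≤
      d.factorial * (b ^ (c * n) * V) ^ d := by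
    have := Matrix.det_le (A := (M.map (algebraMap F[X] Ω)).updateCol i₀ v)
      (abv := NormedField.toAbsoluteValue Ω) (x := b ^ (c * n) * V) (fun i j => by
        change ‖_‖ ≤ _
        have hbn : 1 ≤ b ^ (c * n) := one_le_pow₀ hb
        rw [updateCol_apply]
        split_ifs
        · exact (hV i).trans (le_mul_of_one_le_left (by linarith) hbn)
        · exact ((hle _).trans (pow_le_pow_right₀ hb (hdeg i j))).trans
            (le_mul_of_one_le_right (by linarith) hV1))
    rwa [Fintype.card_fin, nsmul_eq_mul] at this
  have key : ‖v i₀‖ ≤ D' ^ n * ‖γ‖ * (d.factorial * (b ^ (c * n) * V) ^ d) := by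
    calc ‖v i₀‖ ≤ ‖algebraMap F[X] Ω M.det‖ * ‖v i₀‖ :=
          le_mul_of_one_le_left hv0.le (hge _ hdet)
      _ = ‖δ‖ * ‖((M.map (algebraMap F[X] Ω)).updateCol i₀ v).det‖ := by
          rw [← norm_mul, hcr, norm_mul]
      _ ≤ ‖δ‖ * (d.factorial * (b ^ (c * n) * V) ^ d) := by gcongr
      _ = _ := by rw [norm_mul, norm_pow]
  have key' : 1 ≤ B₁ ^ n * B₂ * ‖γ‖ := by
    have h1 : B₁ ^ n * B₂ * ‖γ‖ =
        D' ^ n * ‖γ‖ * (d.factorial * (b ^ (c * n) * V) ^ d) / ‖v i₀‖ := by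
      simp only [B₁, B₂]
      rw [mul_pow, mul_pow, ← pow_mul, ← pow_mul, show c * d * n = c * n * d by ring]
      ring
    rw [h1, one_le_div hv0]
    exact key
  refine key'.trans ?_
  rw [pow_succ]
  gcongr
  · exact (le_max_left _ _).trans (le_max_right _ _)
  · exact (le_max_right _ _).trans (le_max_right _ _)

end Liouville

/-! ### A common vector for two algebraic elements -/

section Frame

variable {F : Type*} [Field F] {Ω : Type*} [Field Ω] [Algebra F[X] Ω]

/-- Two algebraic elements act on a common vector with independent entries through matrices over
the fraction field of `F[X]`. -/
theorem exists_linearIndependent_mulVec_eq (K : Type*) [Field K] [Algebra F[X] K]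
    [IsFractionRing F[X] K] [Algebra K Ω] [IsScalarTower F[X] K Ω] {α β : Ω}
    (hα : IsAlgebraic K α) (hβ : IsAlgebraic K β) :
    ∃ (d : ℕ) (v : Fin d → Ω) (D : F[X]) (Mα Mβ : Matrix (Fin d) (Fin d) F[X]), 0 < d ∧
      LinearIndependent F[X] v ∧ D ≠ 0 ∧
      Mα.map (algebraMap F[X] Ω) *ᵥ v = (algebraMap F[X] Ω D * α) • v ∧
      Mβ.map (algebraMap F[X] Ω) *ᵥ v = (algebraMap F[X] Ω D * β) • v := by
  let L := IntermediateField.adjoin K {α, β}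
  have : FiniteDimensional K L :=
    IntermediateField.finiteDimensional_adjoin_pair hα.isIntegral hβ.isIntegral
  -- The vector is a basis of K(α, β) over K; D is a common denominator of the two multiplication
  -- matrices.
  let e := Module.finBasis K L
  let x : Bool → L := fun t => if t then
    ⟨α, IntermediateField.subset_adjoin _ _ (by simp)⟩ else
    ⟨β, IntermediateField.subset_adjoin _ _ (by simp)⟩
  obtain ⟨D, hD⟩ := IsLocalization.exist_integer_multiples_of_finite (nonZeroDivisors F[X])
    (fun p : Bool × Fin (Module.finrank K L) × Fin (Module.finrank K L) =>
      e.repr (x p.1 * e p.2.1) p.2.2)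
  choose M hM using hD
  have hmul : ∀ t, (Matrix.of fun i j => M (t, i, j)).map (algebraMap F[X] Ω) *ᵥ
      (fun i => (e i : Ω)) = (algebraMap F[X] Ω D * x t) • fun i => (e i : Ω) := by
    intro t
    ext i
    have h1 : ∑ j, e.repr (x t * e i) j • (e j : Ω) = x t * e i := by
      have := congrArg L.val (e.sum_repr (x t * e i))
      rwa [map_sum] at this
    rw [Pi.smul_apply, smul_eq_mul, mul_assoc, ← h1, Finset.mul_sum]
    simp only [Matrix.mulVec, dotProduct]
    refine Finset.sum_congr rfl fun j _ => ?_
    rw [Matrix.map_apply, Matrix.of_apply, IsScalarTower.algebraMap_apply F[X] K Ω (M _), hM,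
      Algebra.smul_def, map_mul, ← IsScalarTower.algebraMap_apply, Algebra.smul_def, mul_assoc]
  refine ⟨Module.finrank K L, fun i => (e i : Ω), D, _, _, Module.finrank_pos, ?_,
    nonZeroDivisors.coe_ne_zero D, hmul true, hmul false⟩
  have h1 : LinearIndependent K fun i => (e i : Ω) :=
    e.linearIndependent.map' L.val.toLinearMap (LinearMap.ker_eq_bot.2 L.val.injective)
  exact h1.restrict_scalars' F[X]

end Frame

end Carlitz

namespace Carlitz

open Polynomial Filter Topology

/-! ### The auxiliary polynomial -/

section Auxiliary

/-- The construction of an auxiliary polynomial by linear algebra. -/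
theorem exists_pow_dvd_eval {R : Type*} [CommRing R] [Nontrivial R] (f : R[X]) (N : ℕ) :
    ∃ P : R[X][X], P ≠ 0 ∧ P.natDegree ≤ N ∧ (∀ j, (P.coeff j).natDegree ≤ N) ∧
      X ^ N ^ 2 ∣ P.eval f := by
  let T : (Fin (N + 1) × Fin (N + 1) → R) →ₗ[R] (Fin (N ^ 2) → R) :=
    Matrix.mulVecLin (Matrix.of fun l p => (X ^ (p.1 : ℕ) * f ^ (p.2 : ℕ)).coeff l)
  -- There are (N + 1)² unknown coefficients and only N² equations.
  have hT : ¬ Function.Injective T := fun h => by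
    have := card_le_of_injective R T h
    simp only [Fintype.card_prod, Fintype.card_fin] at this
    nlinarith
  rw [← LinearMap.ker_eq_bot, LinearMap.ker_eq_bot'] at hT
  push Not at hT
  obtain ⟨a, ha, ha0⟩ := hT
  refine ⟨∑ p : Fin (N + 1) × Fin (N + 1), monomial p.2 (monomial p.1 (a p)), ?_, ?_, ?_, ?_⟩
  · obtain ⟨⟨i, j⟩, hp⟩ := Function.ne_iff.1 ha0
    intro h0
    apply hp
    have := congrArg (fun Q : R[X][X] => (Q.coeff j).coeff i) h0
    simpa [finsetSum_coeff, coeff_monomial, Fintype.sum_prod_type, Fin.val_inj, apply_ite,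
      Finset.sum_ite_eq, ite_apply] using this
  · refine natDegree_sum_le_of_forall_le _ _ fun p _ => ?_
    exact (natDegree_monomial_le _).trans (Nat.lt_succ_iff.1 p.2.2)
  · intro j
    rw [finsetSum_coeff]
    refine natDegree_sum_le_of_forall_le _ _ fun p _ => ?_
    rw [coeff_monomial]
    split_ifs
    · exact (natDegree_monomial_le _).trans (Nat.lt_succ_iff.1 p.1.2)
    · simp
  · rw [X_pow_dvd_iff]
    intro l hl
    have := congrFun ha ⟨l, hl⟩
    rw [eval_finsetSum, finsetSum_coeff]
    simp only [T, Matrix.mulVecLin_apply, Matrix.mulVec, dotProduct, Matrix.of_apply,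
      Pi.zero_apply] at this
    rw [← this]
    refine Finset.sum_congr rfl fun p _ => ?_
    rw [eval_monomial, ← C_mul_X_pow_eq_monomial, mul_assoc, coeff_C_mul, mul_comm]

/-! ### Partial products and the degrees in θ of their coefficients -/

variable (F : Type*) [Field F]

/-- The polynomial `∏_{1 ≤ n ≤ m} (1 - θ X ^ (q ^ n))` over `F[θ]`. -/
noncomputable def partialProd (q m : ℕ) : F[X][X] :=
  ∏ n ∈ Finset.range m, (1 - C X * X ^ q ^ (n + 1))

variable {F} {q : ℕ}

theorem X_pow_dvd_partialProd_sub (hq : 2 ≤ q) {m m' : ℕ} (h : m ≤ m') :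
    X ^ q ^ (m + 1) ∣ partialProd F q m' - partialProd F q m := by
  induction m', h using Nat.le_induction with
  | base => simp
  | succ k hk ih =>
    have h1 : partialProd F q (k + 1) - partialProd F q m =
        (partialProd F q k - partialProd F q m) -
          partialProd F q k * C X * X ^ q ^ (k + 1) := by
      rw [partialProd, Finset.prod_range_succ, ← partialProd]
      ring
    rw [h1]
    refine dvd_sub ih (Dvd.dvd.mul_left (pow_dvd_pow _ ?_) _)
    exact Nat.pow_le_pow_right (by omega) (by omega)

theorem X_pow_dvd_eval_partialProd_sub (hq : 2 ≤ q) (P : F[X][X][X]) {m m' : ℕ} (h : m ≤ m') :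
    X ^ q ^ (m + 1) ∣ P.eval (partialProd F q m') - P.eval (partialProd F q m) :=
  (X_pow_dvd_partialProd_sub hq h).trans (sub_dvd_eval_sub _ _ _)

/-- The coefficients of `p` have degree at most `h`. -/
def CoeffDegreeLE (h : ℕ) (p : F[X][X]) : Prop := ∀ i, (p.coeff i).natDegree ≤ h

theorem exists_coeffDegreeLE (p : F[X][X]) : ∃ h, CoeffDegreeLE h p := by
  refine ⟨p.support.sup fun i => (p.coeff i).natDegree, fun i => ?_⟩
  by_cases hi : i ∈ p.support
  · exact Finset.le_sup (f := fun i => (p.coeff i).natDegree) hi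
  · simp [notMem_support_iff.1 hi]

theorem exists_forall_coeffDegreeLE (P : F[X][X][X]) : ∃ h, ∀ j, CoeffDegreeLE h (P.coeff j) := by
  choose h hh using fun j => exists_coeffDegreeLE (P.coeff j)
  refine ⟨P.support.sup h, fun j i => ?_⟩
  by_cases hj : j ∈ P.support
  · exact (hh j i).trans (Finset.le_sup (f := h) hj)
  · simp [notMem_support_iff.1 hj]

theorem CoeffDegreeLE.mono {h h' : ℕ} {p : F[X][X]} (hp : CoeffDegreeLE h p) (hh : h ≤ h') :
    CoeffDegreeLE h' p := fun i => (hp i).trans hh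

theorem CoeffDegreeLE.mul {h h' : ℕ} {p p' : F[X][X]} (hp : CoeffDegreeLE h p)
    (hp' : CoeffDegreeLE h' p') : CoeffDegreeLE (h + h') (p * p') := fun i => by
  rw [coeff_mul]
  exact natDegree_sum_le_of_forall_le _ _ fun k _ =>
    natDegree_mul_le.trans (Nat.add_le_add (hp _) (hp' _))

theorem CoeffDegreeLE.sum {κ : Type*} {h : ℕ} {p : κ → F[X][X]} (s : Finset κ)
    (hp : ∀ k ∈ s, CoeffDegreeLE h (p k)) : CoeffDegreeLE h (∑ k ∈ s, p k) := fun i => by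
  rw [finsetSum_coeff]
  exact natDegree_sum_le_of_forall_le _ _ fun k hk => hp k hk i

theorem coeffDegreeLE_one : CoeffDegreeLE 0 (1 : F[X][X]) := fun i => by
  rw [coeff_one]
  split_ifs <;> simp

theorem CoeffDegreeLE.pow {h : ℕ} {p : F[X][X]} (hp : CoeffDegreeLE h p) (j : ℕ) :
    CoeffDegreeLE (j * h) (p ^ j) := by
  induction j with
  | zero => simpa using coeffDegreeLE_one
  | succ j ih => rw [pow_succ, Nat.succ_mul]; exact ih.mul hp

/-- Each factor is linear in θ. This growth, linear in m, is what the order q ^ (m + 1) of agreement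
with f has to beat. -/
theorem coeffDegreeLE_partialProd (q m : ℕ) : CoeffDegreeLE m (partialProd F q m) := by
  induction m with
  | zero => simpa [partialProd] using coeffDegreeLE_one
  | succ m ih =>
    rw [partialProd, Finset.prod_range_succ, ← partialProd]
    refine ih.mul fun i => ?_
    rw [coeff_sub, coeff_one, coeff_C_mul, coeff_X_pow]
    refine (natDegree_sub_le _ _).trans (max_le ?_ ?_) <;> split_ifs <;> simp

theorem coeffDegreeLE_eval_partialProd {h : ℕ} {P : F[X][X][X]}
    (hP : ∀ j, CoeffDegreeLE h (P.coeff j)) (q m : ℕ) :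
    CoeffDegreeLE (h + P.natDegree * m) (P.eval (partialProd F q m)) := by
  rw [eval_eq_sum_range]
  refine CoeffDegreeLE.sum _ fun j hj => ?_
  refine ((hP j).mul ((coeffDegreeLE_partialProd q m).pow j)).mono ?_
  gcongr
  exact Nat.lt_succ_iff.1 (Finset.mem_range.1 hj)

/-! ### Functional transcendence of the product -/

variable {Ω : Type*} [NormedField Ω] [Algebra F[X] Ω] {b : ℝ}

/-- Comparison with a geometric series makes the bound independent of the degree of p in x, which
for partial products grows exponentially. -/
theorem norm_aeval_le_of_X_pow_dvd (hb : 1 ≤ b)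
    (hle : ∀ a : F[X], ‖algebraMap F[X] Ω a‖ ≤ b ^ a.natDegree) {h e : ℕ} {p : F[X][X]}
    (hp : CoeffDegreeLE h p) (he : X ^ e ∣ p) {x : Ω} (hx : ‖x‖ < 1) :
    ‖aeval x p‖ ≤ ‖x‖ ^ e * (b ^ h * (1 - ‖x‖)⁻¹) := by
  obtain ⟨r, rfl⟩ := he
  have hr : CoeffDegreeLE h r := fun i => by
    have := hp (i + e)
    rwa [coeff_X_pow_mul] at this
  rw [map_mul, map_pow, aeval_X, norm_mul, norm_pow]
  refine mul_le_mul_of_nonneg_left ?_ (by positivity)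
  rw [aeval_eq_sum_range, ← tsum_geometric_of_lt_one (norm_nonneg x) hx, ← tsum_mul_left]
  refine (norm_sum_le _ _).trans (le_trans (Finset.sum_le_sum fun i _ => ?_)
    (Summable.sum_le_tsum (Finset.range (r.natDegree + 1)) (fun i _ => by positivity)
      ((summable_geometric_of_lt_one (norm_nonneg x) hx).mul_left (b ^ h))))
  rw [Algebra.smul_def, norm_mul, norm_pow]
  gcongr
  exact (hle _).trans (pow_le_pow_right₀ hb (hr i))

theorem tendsto_pow_pow_mul_pow (hq : 2 ≤ q) {t : ℝ} (ht0 : 0 ≤ t) (ht1 : t < 1) {B : ℝ}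
    (hB : 0 ≤ B) : Tendsto (fun m : ℕ => t ^ q ^ (m + 1) * B ^ m) atTop (𝓝 0) := by
  have h1 : Tendsto (fun m : ℕ => t ^ m * B) atTop (𝓝 0) := by
    simpa using (tendsto_pow_atTop_nhds_zero_of_lt_one ht0 ht1).mul_const B
  refine tendsto_of_tendsto_of_tendsto_of_le_of_le' tendsto_const_nhds
    (tendsto_pow_atTop_nhds_zero_of_lt_one (r := (1 / 2 : ℝ)) (by norm_num) (by norm_num))
    (Eventually.of_forall fun m => by positivity) ?_
  filter_upwards [h1.eventually_le_const (show (0 : ℝ) < 1 / 2 by norm_num)] with m hm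
  have h2 : m * m ≤ q ^ (m + 1) := by
    have h4 : ∀ m : ℕ, m * m ≤ 2 ^ (m + 1) := fun m => by
      induction m using Nat.strong_induction_on with
      | _ m ih =>
        rcases Nat.lt_or_ge m 4 with h | h
        · interval_cases m <;> norm_num
        · obtain ⟨k, rfl⟩ := Nat.exists_eq_add_of_le' h
          have := ih (k + 3) (by omega)
          rw [show k + 4 + 1 = (k + 3 + 1) + 1 by rfl, pow_succ]
          nlinarith
    exact (h4 m).trans (Nat.pow_le_pow_left hq _)
  calc t ^ q ^ (m + 1) * B ^ m ≤ t ^ (m * m) * B ^ m := by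
        gcongr ?_ * _
        exact pow_le_pow_of_le_one ht0 ht1.le h2
    _ = (t ^ m * B) ^ m := by rw [mul_pow, pow_mul]
    _ ≤ (1 / 2) ^ m := by gcongr

theorem aeval_partialProd (x : Ω) (m : ℕ) : aeval x (partialProd F q m) =
    ∏ n ∈ Finset.range m, (1 - algebraMap F[X] Ω X * x ^ q ^ (n + 1)) := by
  simp [partialProd]

/-- The formal product `∏_{n ≥ 1} (1 - θ X ^ (q ^ n))` is not algebraic over `F(θ)(X)`. -/
theorem exists_not_X_pow_dvd_eval_partialProd (hq : 2 ≤ q) (hb : 1 < b)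
    (hle : ∀ a : F[X], ‖algebraMap F[X] Ω a‖ ≤ b ^ a.natDegree)
    (hge : ∀ a : F[X], a ≠ 0 → 1 ≤ ‖algebraMap F[X] Ω a‖)
    (hθ : 1 < ‖algebraMap F[X] Ω X‖)
    (hroot : ∀ n : ℕ, ∃ x : Ω, algebraMap F[X] Ω X * x ^ q ^ (n + 1) = 1)
    {P : F[X][X][X]} (hP : P ≠ 0) :
    ∃ m, ¬ X ^ q ^ (m + 1) ∣ P.eval (partialProd F q m) := by
  by_contra! hdvd
  -- Each p_m is 1 modulo x, so a power of y can be removed from P without losing divisibility.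
  have hcop : ∀ m, IsCoprime (X : F[X][X]) (partialProd F q m) := fun m => by
    refine IsCoprime.prod_right fun n _ => ?_
    refine ⟨C X * X ^ (q ^ (n + 1) - 1), 1, ?_⟩
    have : (X : F[X][X]) ^ q ^ (n + 1) = X ^ (q ^ (n + 1) - 1) * X := by
      rw [← pow_succ, Nat.sub_add_cancel (Nat.one_le_pow _ _ (by omega))]
    rw [this]
    ring
  obtain ⟨P', hP', hnd⟩ := exists_eq_pow_rootMultiplicity_mul_and_not_dvd P hP 0
  rw [C_0, sub_zero] at hP' hnd
  have hdvd' : ∀ m, X ^ q ^ (m + 1) ∣ P'.eval (partialProd F q m) := fun m => by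
    have := hdvd m
    rw [hP', eval_mul, eval_pow, eval_X] at this
    exact ((hcop m).pow).dvd_of_dvd_mul_left this
  have hp0 : P'.coeff 0 ≠ 0 := fun h => hnd (X_dvd_iff.2 h)
  obtain ⟨h, hh⟩ := exists_forall_coeffDegreeLE P'
  have hinj : Function.Injective (algebraMap F[X] Ω) := by
    refine (injective_iff_map_eq_zero _).2 fun a ha => ?_
    by_contra h0
    have := hge a h0
    rw [ha, norm_zero] at this
    linarith
  choose x hx using hroot
  have hxn : ∀ n, ‖x n‖ < 1 := fun n => by
    by_contra! h1
    have h2 := congrArg norm (hx n)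
    rw [norm_mul, norm_pow, norm_one] at h2
    have h3 := one_le_pow₀ h1 (n := q ^ (n + 1))
    nlinarith
  -- Once m > n the point x n is a zero of p_m, so P'(x n, p_m(x n)) is the fixed number P'(x n, 0);
  -- divisibility by x^(q^(m+1)) makes it arbitrarily small.
  have hzero : ∀ n, aeval (x n) (P'.coeff 0) = 0 := fun n => by
    have h1 : ∀ m, n < m → aeval (x n) (P'.eval (partialProd F q m)) =
        aeval (x n) (P'.coeff 0) := fun m hm => by
      have h2 : aeval (x n) (partialProd F q m) = 0 := by
        rw [aeval_partialProd]
        exact Finset.prod_eq_zero (Finset.mem_range.2 hm) (by rw [hx n, sub_self])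
      obtain ⟨s, hs⟩ := sub_dvd_eval_sub (partialProd F q m) 0 P'
      rw [sub_zero, sub_eq_iff_eq_add, ← coeff_zero_eq_eval_zero] at hs
      rw [hs, map_add, map_mul, h2, zero_mul, zero_add]
    have hlim := (tendsto_pow_pow_mul_pow hq (norm_nonneg (x n)) (hxn n)
      (B := b ^ P'.natDegree) (by positivity)).mul_const (b ^ h * (1 - ‖x n‖)⁻¹)
    rw [zero_mul] at hlim
    have hb0 : ‖aeval (x n) (P'.coeff 0)‖ ≤ 0 := by
      refine ge_of_tendsto hlim ?_
      filter_upwards [eventually_gt_atTop n] with m hm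
      rw [← h1 m hm]
      refine (norm_aeval_le_of_X_pow_dvd hb.le hle (coeffDegreeLE_eval_partialProd hh q m)
        (hdvd' m) (hxn n)).trans_eq ?_
      rw [pow_add, pow_mul]
      ring
    simpa using hb0
  -- If x n = x k with n < k, then y = x n ^ q ^ (n + 1) satisfies y ^ q ^ (k - n) = y, impossible
  -- for 0 < |y| < 1.
  have hxinj : Function.Injective x := by
    refine Function.Injective.of_lt_imp_ne fun n k hnk hEq => ?_
    obtain ⟨l, rfl⟩ := Nat.exists_eq_add_of_lt hnk
    have h1 := hx (n + l + 1)
    rw [← hEq, show n + l + 1 + 1 = (n + 1) + (l + 1) by ring, pow_add, pow_mul] at h1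
    have h2 : ‖x n ^ q ^ (n + 1)‖ < 1 := by
      rw [norm_pow]
      exact pow_lt_one₀ (norm_nonneg _) (hxn n) (pow_ne_zero _ (by omega))
    have h3 : algebraMap F[X] Ω X ≠ 0 := fun h0 => by
      rw [h0, norm_zero] at hθ
      linarith
    have h4 := mul_left_cancel₀ h3 (h1.trans (hx n).symm)
    set y := x n ^ q ^ (n + 1) with hy
    have hy0 : y ≠ 0 := fun h0 => by
      have := hx n
      rw [← hy, h0, mul_zero] at this
      exact zero_ne_one this
    have h5 : q ^ (l + 1) = (q ^ (l + 1) - 1) + 1 :=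
      (Nat.sub_add_cancel (Nat.one_le_pow _ _ (by omega))).symm
    rw [h5, pow_succ] at h4
    have h6 := mul_right_cancel₀ hy0 (h4.trans (one_mul y).symm)
    have h7 : ‖y‖ ^ (q ^ (l + 1) - 1) < 1 :=
      pow_lt_one₀ (norm_nonneg _) h2 (by
        have : 2 ≤ q ^ (l + 1) := hq.trans (Nat.le_self_pow (by omega) q)
        omega)
    rw [← norm_pow, h6, norm_one] at h7
    exact lt_irrefl _ h7
  refine Polynomial.map_ne_zero_iff hinj |>.2 hp0 ?_
  refine eq_zero_of_infinite_isRoot _ ((Set.infinite_range_of_injective hxinj).mono ?_)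
  rintro _ ⟨n, rfl⟩
  change eval _ _ = 0
  rw [eval_map_algebraMap]
  exact hzero n

end Auxiliary

end Carlitz

namespace Carlitz

open Polynomial Filter Topology Asymptotics

/-! ### The product as a function near 0 -/

section Analytic

variable {Ω : Type*} [NormedField Ω] {θ : Ω} {q : ℕ}

theorem add_le_pow_succ (hq : 2 ≤ q) (n : ℕ) : q + n ≤ q ^ (n + 1) := by
  have h1 : n + 1 ≤ q ^ n := Nat.lt_pow_self (by omega)
  rw [pow_succ]
  nlinarith

theorem norm_mul_pow_pow_le (hq : 2 ≤ q) {x : Ω} (hx : ‖x‖ ≤ 1) (n : ℕ) :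
    ‖-(θ * x ^ q ^ (n + 1))‖ ≤ ‖θ‖ * ‖x‖ ^ q * ‖x‖ ^ n := by
  rw [norm_neg, norm_mul, norm_pow, mul_assoc, ← pow_add]
  exact mul_le_mul_of_nonneg_left
    (pow_le_pow_of_le_one (norm_nonneg _) hx (add_le_pow_succ hq n)) (norm_nonneg _)

theorem summable_norm_mul_pow_pow (hq : 2 ≤ q) {x : Ω} (hx : ‖x‖ < 1) :
    Summable fun n : ℕ => ‖-(θ * x ^ q ^ (n + 1))‖ :=
  Summable.of_nonneg_of_le (fun _ => norm_nonneg _) (norm_mul_pow_pow_le hq hx.le)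
    ((summable_geometric_of_lt_one (norm_nonneg _) hx).mul_left _)

variable (θ q) in
/-- The product `∏_{n ≥ 1} (1 - θ x ^ (q ^ n))`. -/
noncomputable def mahlerProd (x : Ω) : Ω := ∏' n : ℕ, (1 - θ * x ^ q ^ (n + 1))

variable [CompleteSpace Ω]

theorem multipliable_one_sub_mul_pow_pow (hq : 2 ≤ q) {x : Ω} (hx : ‖x‖ < 1) :
    Multipliable fun n : ℕ => 1 - θ * x ^ q ^ (n + 1) := by
  simp_rw [sub_eq_add_neg]
  exact multipliable_one_add_of_summable (summable_norm_mul_pow_pow hq hx)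

/-- Mahler's functional equation, iterated k times. -/
theorem mahlerProd_eq (hq : 2 ≤ q) {x : Ω} (hx : ‖x‖ < 1) (k : ℕ) :
    mahlerProd θ q x =
      (∏ n ∈ Finset.range k, (1 - θ * x ^ q ^ (n + 1))) * mahlerProd θ q (x ^ q ^ k) := by
  have h1 : ∀ n, 1 - θ * (x ^ q ^ k) ^ q ^ (n + 1) = 1 - θ * x ^ q ^ (n + k + 1) := fun n => by
    rw [← pow_mul, ← pow_add]
    congr 4
    ring
  have h2 : ‖x ^ q ^ k‖ < 1 := by
    rw [norm_pow]
    exact pow_lt_one₀ (norm_nonneg _) hx (pow_ne_zero _ (by omega))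
  have h3 := multipliable_one_sub_mul_pow_pow (θ := θ) hq h2
  simp_rw [h1] at h3
  simp_rw [mahlerProd, h1]
  exact (Multipliable.prod_mul_tprod_nat_mul' (f := fun n => 1 - θ * x ^ q ^ (n + 1)) h3).symm

theorem norm_mahlerProd_sub_one_le (hq : 2 ≤ q) {x : Ω} (hx : ‖x‖ ≤ 1 / 2) :
    ‖mahlerProd θ q x - 1‖ ≤ Real.exp (2 * ‖θ‖ * ‖x‖ ^ q) - 1 := by
  have hx1 : ‖x‖ < 1 := by linarith
  have hlim := (multipliable_one_sub_mul_pow_pow (θ := θ) hq hx1).hasProd.tendsto_prod_nat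
  refine le_of_tendsto (hlim.sub_const 1).norm (Eventually.of_forall fun m => ?_)
  simp_rw [sub_eq_add_neg (1 : Ω) (θ * _)]
  refine (Finset.norm_prod_one_add_sub_one_le _ _).trans ?_
  gcongr
  calc ∑ n ∈ Finset.range m, ‖-(θ * x ^ q ^ (n + 1))‖
      ≤ ∑ n ∈ Finset.range m, ‖θ‖ * ‖x‖ ^ q * ‖x‖ ^ n :=
        Finset.sum_le_sum fun n _ => norm_mul_pow_pow_le hq hx1.le n
    _ = ‖θ‖ * ‖x‖ ^ q * ∑ n ∈ Finset.range m, ‖x‖ ^ n := (Finset.mul_sum _ _ _).symm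
    _ ≤ ‖θ‖ * ‖x‖ ^ q * ∑' n : ℕ, ‖x‖ ^ n := by
        gcongr
        exact (summable_geometric_of_lt_one (norm_nonneg _) hx1).sum_le_tsum _
          fun _ _ => by positivity
    _ ≤ ‖θ‖ * ‖x‖ ^ q * 2 := by
        gcongr
        rw [tsum_geometric_of_lt_one (norm_nonneg _) hx1]
        rw [inv_le_comm₀ (by linarith) (by norm_num)]
        linarith
    _ = 2 * ‖θ‖ * ‖x‖ ^ q := by ring

theorem isBigO_mahlerProd_sub_one (hq : 2 ≤ q) :
    (fun x : Ω => mahlerProd θ q x - 1) =O[𝓝 0] fun x => x ^ q := by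
  have h1 : (fun t : ℝ => Real.exp t - 1) =O[𝓝 0] fun t => t := by
    have := (Real.hasDerivAt_exp 0).isBigO_sub
    simpa using this
  have h2 : Tendsto (fun x : Ω => 2 * ‖θ‖ * ‖x‖ ^ q) (𝓝 0) (𝓝 0) := by
    have : Continuous fun x : Ω => 2 * ‖θ‖ * ‖x‖ ^ q := by fun_prop
    simpa [show q ≠ 0 by omega] using this.tendsto 0
  have h3 : (fun x : Ω => mahlerProd θ q x - 1) =O[𝓝 0]
      fun x => Real.exp (2 * ‖θ‖ * ‖x‖ ^ q) - 1 := by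
    refine IsBigO.of_bound 1 ?_
    have : ∀ᶠ x : Ω in 𝓝 0, ‖x‖ < 1 / 2 := by
      filter_upwards [Metric.ball_mem_nhds (0 : Ω) (show (0 : ℝ) < 1 / 2 by norm_num)] with x hx
      exact mem_ball_zero_iff.1 hx
    filter_upwards [this] with x hx
    rw [one_mul]
    exact (norm_mahlerProd_sub_one_le hq hx.le).trans (le_abs_self _)
  refine h3.trans ((h1.comp_tendsto h2).trans ?_)
  refine IsBigO.of_bound (2 * ‖θ‖) (Eventually.of_forall fun x => ?_)
  simp

variable {F : Type*} [Field F] [Algebra F[X] Ω]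

omit [CompleteSpace Ω] in
theorem continuous_aeval_polynomial (p : F[X][X]) : Continuous fun x : Ω => aeval x p := by
  simp_rw [← eval_map_algebraMap]
  exact Polynomial.continuous _

local notation "Θ" => algebraMap F[X] Ω X

/-- By the functional equation the difference is p_m(x) (f(x^(q^m)) - 1), and f(z) - 1 = O(z^q). -/
theorem isBigO_mahlerProd_sub_partialProd (hq : 2 ≤ q) (m : ℕ) :
    (fun x : Ω => mahlerProd Θ q x - aeval x (partialProd F q m)) =O[𝓝 0]
      fun x => x ^ q ^ (m + 1) := by
  have h0 : q ^ m ≠ 0 := pow_ne_zero _ (by omega)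
  have h1 : Tendsto (fun x : Ω => x ^ q ^ m) (𝓝 0) (𝓝 0) := by
    have := (continuous_pow (M := Ω) (q ^ m)).tendsto 0
    rwa [zero_pow h0] at this
  have h2 := ((isBigO_mahlerProd_sub_one (θ := Θ) hq).comp_tendsto h1)
  have h3 : (fun x : Ω => aeval x (partialProd F q m)) =O[𝓝 0] fun _ => (1 : ℝ) :=
    ((continuous_aeval_polynomial _).tendsto 0).isBigO_one ℝ
  have h4 := h3.mul h2.norm_right
  refine (h4.congr' ?_ EventuallyEq.rfl).trans ?_
  · filter_upwards [Metric.ball_mem_nhds (0 : Ω) one_pos] with x hx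
    rw [Function.comp_apply, mahlerProd_eq hq (x := x) (by simpa using hx) m, ← aeval_partialProd]
    ring
  · refine IsBigO.of_bound 1 (Eventually.of_forall fun x => ?_)
    simp [← pow_mul, pow_succ]

theorem isBigO_eval₂_mahlerProd_sub (hq : 2 ≤ q) (P : F[X][X][X]) (m : ℕ) :
    (fun x : Ω => P.eval₂ (aeval x : F[X][X] →ₐ[F[X]] Ω).toRingHom (mahlerProd Θ q x) -
      aeval x (P.eval (partialProd F q m))) =O[𝓝 0] fun x => x ^ q ^ (m + 1) := by
  set f : Ω → Ω := mahlerProd Θ q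
  set p : Ω → Ω := fun x => aeval x (partialProd F q m)
  have hfp : (fun x => f x - p x) =O[𝓝 0] fun x => x ^ q ^ (m + 1) :=
    isBigO_mahlerProd_sub_partialProd hq m
  have hp : p =O[𝓝 0] fun _ => (1 : Ω) :=
    ((continuous_aeval_polynomial _).tendsto 0).isBigO_one Ω
  have hf : f =O[𝓝 0] fun _ => (1 : Ω) := by
    have h1 : (fun x : Ω => x ^ q ^ (m + 1)) =O[𝓝 0] fun _ => (1 : Ω) :=
      ((continuous_pow (M := Ω) _).tendsto 0).isBigO_one Ω
    simpa using (hfp.trans h1).add hp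
  have hpow : ∀ j, (fun x => f x ^ j - p x ^ j) =O[𝓝 0] fun x => x ^ q ^ (m + 1) := fun j => by
    induction j with
    | zero => simpa using isBigO_zero _ _
    -- Uses f^(j+1) - p^(j+1) = f^j (f - p) + (f^j - p^j) p.
    | succ j ih =>
      have h1 := ((hf.pow j).mul hfp).add (ih.mul hp |>.congr_right fun x => by
        rw [one_pow, mul_comm])
      refine (h1.congr_left fun x => ?_).congr_right fun x => ?_
      · ring
      · rw [one_pow, one_mul]
  induction P using Polynomial.induction_on' with
  | add P Q hP hQ =>
    refine (hP.add hQ).congr_left fun x => ?_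
    rw [eval₂_add, eval_add, map_add]
    ring
  | monomial j a =>
    have ha : (fun x : Ω => aeval x a) =O[𝓝 0] fun _ => (1 : Ω) :=
      ((continuous_aeval_polynomial _).tendsto 0).isBigO_one Ω
    refine ((ha.mul (hpow j)).congr_left fun x => ?_).congr_right fun x => one_mul _
    rw [eval₂_monomial, eval_monomial, map_mul, map_pow]
    change _ = aeval x a * f x ^ j - aeval x a * p x ^ j
    ring

/-- The order of vanishing at `0` of `P(x, f(x))` can be read off the partial products. -/
theorem exists_eventually_eval₂_mahlerProd (hq : 2 ≤ q)
    (hinj : Function.Injective (algebraMap F[X] Ω)) {P : F[X][X][X]} {m e : ℕ}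
    (hm : ¬ X ^ q ^ (m + 1) ∣ P.eval (partialProd F q m))
    (he : X ^ e ∣ P.eval (partialProd F q m)) :
    ∃ C : ℝ, ∀ᶠ x : Ω in 𝓝[≠] 0,
      P.eval₂ (aeval x : F[X][X] →ₐ[F[X]] Ω).toRingHom (mahlerProd Θ q x) ≠ 0 ∧
      ‖P.eval₂ (aeval x : F[X][X] →ₐ[F[X]] Ω).toRingHom (mahlerProd Θ q x)‖ ≤ C * ‖x‖ ^ e := by
  set Q := P.eval (partialProd F q m) with hQ
  have hQ0 : Q ≠ 0 := fun h => hm (h ▸ dvd_zero _)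
  obtain ⟨T, hT, hnd⟩ := exists_eq_pow_rootMultiplicity_mul_and_not_dvd Q hQ0 0
  set M := rootMultiplicity 0 Q with hM
  rw [C_0, sub_zero] at hT hnd
  have hMlt : M < q ^ (m + 1) := by
    by_contra! h
    exact hm ((pow_dvd_pow _ h).trans (hT ▸ dvd_mul_right _ _))
  have heM : e ≤ M := by
    rw [hM, le_rootMultiplicity_iff hQ0, C_0, sub_zero]
    exact he
  have hc : (algebraMap F[X] Ω (T.coeff 0)) ≠ 0 := fun h =>
    hnd (X_dvd_iff.2 ((injective_iff_map_eq_zero _).1 hinj _ h))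
  set c := algebraMap F[X] Ω (T.coeff 0) with hcdef
  have hcpos : 0 < ‖c‖ := norm_pos_iff.2 hc
  have hTlim : Tendsto (fun x : Ω => ‖aeval x T‖) (𝓝 0) (𝓝 ‖c‖) := by
    have := ((continuous_aeval_polynomial (Ω := Ω) T).tendsto 0).norm
    rwa [← coeff_zero_eq_aeval_zero'] at this
  -- Since M < q ^ (m + 1), the error is negligible against Q(x) ~ c x^M. Near 0 it is at most |c|/4
  -- · |x|^M, and |T(x)| lies between |c|/2 and 2|c|; this gives both nonvanishing and the constant
  -- 3|c|.
  have hr := (isBigO_eval₂_mahlerProd_sub (Ω := Ω) hq P m).trans_isLittleO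
    (isLittleO_pow_pow (𝕜 := Ω) hMlt)
  have hr' := hr.bound (show 0 < ‖c‖ / 4 by positivity)
  refine ⟨3 * ‖c‖, ?_⟩
  filter_upwards [nhdsWithin_le_nhds hr', self_mem_nhdsWithin,
    nhdsWithin_le_nhds (hTlim.eventually_const_lt (show ‖c‖ / 2 < ‖c‖ by linarith)),
    nhdsWithin_le_nhds (hTlim.eventually_lt_const (show ‖c‖ < 2 * ‖c‖ by linarith)),
    nhdsWithin_le_nhds (Metric.ball_mem_nhds (0 : Ω) one_pos)] with x h1 hx0 h2 h3 h4
  set g := P.eval₂ (aeval x : F[X][X] →ₐ[F[X]] Ω).toRingHom (mahlerProd Θ q x)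
  have hxpos : 0 < ‖x‖ ^ M := pow_pos (norm_pos_iff.2 hx0) _
  have hx1 : ‖x‖ < 1 := by simpa using h4
  have hQx : ‖aeval x Q‖ = ‖x‖ ^ M * ‖aeval x T‖ := by
    rw [hT, map_mul, map_pow, aeval_X, norm_mul, norm_pow]
  rw [← hQ, norm_pow] at h1
  constructor
  · intro hg
    rw [hg, zero_sub, norm_neg, hQx] at h1
    nlinarith
  · have h5 : ‖g‖ ≤ ‖g - aeval x Q‖ + ‖aeval x Q‖ := by
      simpa using norm_add_le (g - aeval x Q) (aeval x Q)
    have h6 : ‖x‖ ^ M ≤ ‖x‖ ^ e := pow_le_pow_of_le_one (norm_nonneg _) hx1.le heM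
    nlinarith

end Analytic

end Carlitz

namespace Carlitz

open Polynomial Filter Topology

/-! ### Mahler's method -/

section Mahler

variable {Ω : Type*} [NormedField Ω] [CompleteSpace Ω] {q : ℕ} {F : Type*} [Field F]
  [Algebra F[X] Ω] {b : ℝ}

local notation "Θ" => algebraMap F[X] Ω X

-- The sizes 1 + q ^ n of the factors form a geometric sum; the constant 3 suffices because 3 q ^ k
-- + 1 + q ^ (k + 1) ≤ 3 q ^ (k + 1) for q ≥ 2.
omit [CompleteSpace Ω] in
theorem hasSize_prod {d : ℕ} {v : Fin d → Ω} {D : F[X]} {c : ℕ} {α : Ω} (hq : 2 ≤ q)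
    (hD : D.natDegree + 1 ≤ c) (hα : HasSize v D c 1 α) (k : ℕ) :
    HasSize v D c (3 * q ^ k) (∏ n ∈ Finset.range k, (1 - Θ * α ^ q ^ (n + 1))) := by
  have hD' : D.natDegree ≤ c := by omega
  induction k with
  | zero =>
    simpa using hasSize_algebraMap (v := v) (Ω := Ω) (n := 3) (a := (1 : F[X])) hD (by simp)
  | succ k ih =>
    rw [Finset.prod_range_succ]
    have h1 : HasSize v D c (1 + q ^ (k + 1)) (1 - Θ * α ^ q ^ (k + 1)) := by
      have h2 : (1 : Ω) - Θ * α ^ q ^ (k + 1) =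
          algebraMap F[X] Ω 1 + algebraMap F[X] Ω (-X) * α ^ q ^ (k + 1) := by
        rw [map_one, map_neg]
        ring
      rw [h2]
      refine (hasSize_algebraMap hD (by simp)).add (HasSize.mul ?_ ?_)
      · exact hasSize_algebraMap hD (by simp)
      · simpa using hα.pow hD (q ^ (k + 1))
    refine (ih.mul h1).mono hD' ?_
    have h3 : 1 ≤ q ^ k := Nat.one_le_pow _ _ (by omega)
    rw [pow_succ]
    nlinarith

omit [CompleteSpace Ω] in
theorem hasSize_aeval {d : ℕ} {v : Fin d → Ω} {D : F[X]} {c : ℕ} {α : Ω}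
    (hD : D.natDegree + 1 ≤ c) (hα : HasSize v D c 1 α) {p : F[X][X]} {h N : ℕ}
    (hp : CoeffDegreeLE h p) (hN : p.natDegree ≤ N) (k : ℕ) :
    HasSize v D c (h + N * k) (aeval (α ^ k) p) := by
  rw [aeval_eq_sum_range]
  refine HasSize.sum hD _ fun i hi => ?_
  rw [Algebra.smul_def, ← pow_mul]
  refine (hasSize_algebraMap hD (hp i)).mul ?_
  refine (hα.pow hD (k * i)).mono (by omega) ?_
  have : i ≤ N := (Nat.lt_succ_iff.1 (Finset.mem_range.1 hi)).trans hN
  rw [mul_one, mul_comm]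
  gcongr

/-- **Denis' theorem**, proved by Mahler's method. -/
theorem transcendental_mahlerProd (K : Type*) [Field K] [Algebra F[X] K] [IsFractionRing F[X] K]
    [Algebra K Ω] [IsScalarTower F[X] K Ω] (hq : 2 ≤ q) (hb : 1 < b)
    (hnorm : ∀ a : F[X], a ≠ 0 → ‖algebraMap F[X] Ω a‖ = b ^ a.natDegree)
    (hroot : ∀ n : ℕ, ∃ x : Ω, Θ * x ^ q ^ (n + 1) = 1)
    {α : Ω} (hα : IsAlgebraic K α) (hα0 : 0 < ‖α‖) (hα1 : ‖α‖ < 1)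
    (hne : ∀ n : ℕ, Θ * α ^ q ^ (n + 1) ≠ 1) : Transcendental K (mahlerProd Θ q α) := by
  intro hβ
  have hge : ∀ a : F[X], a ≠ 0 → 1 ≤ ‖algebraMap F[X] Ω a‖ := fun a ha => by
    rw [hnorm a ha]
    exact one_le_pow₀ hb.le
  have hle : ∀ a : F[X], ‖algebraMap F[X] Ω a‖ ≤ b ^ a.natDegree := fun a => by
    by_cases ha : a = 0
    · simp [ha]
    · exact (hnorm a ha).le
  have hθ : 1 < ‖Θ‖ := by simpa [hnorm X X_ne_zero] using hb
  have hinj : Function.Injective (algebraMap F[X] Ω) := by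
    refine (injective_iff_map_eq_zero _).2 fun a ha => ?_
    by_contra h0
    have := hge a h0
    rw [ha, norm_zero] at this
    linarith
  set β := mahlerProd Θ q α
  obtain ⟨d, v, D, Mα, Mβ, hd, hv, hD0, hMα, hMβ⟩ :=
    exists_linearIndependent_mulVec_eq (F := F) K hα hβ
  obtain ⟨c, hD, hcα, hcβ⟩ : ∃ c, D.natDegree + 1 ≤ c ∧ (∀ i j, (Mα i j).natDegree ≤ c) ∧
      ∀ i j, (Mβ i j).natDegree ≤ c := by
    refine ⟨D.natDegree + 1 + ∑ i, ∑ j, ((Mα i j).natDegree + (Mβ i j).natDegree),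
      by omega, fun i j => ?_, fun i j => ?_⟩ <;>
    · have h1 : (Mα i j).natDegree + (Mβ i j).natDegree ≤
          ∑ j, ((Mα i j).natDegree + (Mβ i j).natDegree) :=
        Finset.single_le_sum (f := fun j => (Mα i j).natDegree + (Mβ i j).natDegree)
          (fun _ _ => Nat.zero_le _) (Finset.mem_univ j)
      have h2 : ∑ j, ((Mα i j).natDegree + (Mβ i j).natDegree) ≤
          ∑ i, ∑ j, ((Mα i j).natDegree + (Mβ i j).natDegree) :=
        Finset.single_le_sum (f := fun i => ∑ j, ((Mα i j).natDegree + (Mβ i j).natDegree))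
          (fun _ _ => Nat.zero_le _) (Finset.mem_univ i)
      omega
  have hsα : HasSize v D c 1 α := ⟨Mα, by rw [hMα, pow_one], fun i j => by simpa using hcα i j⟩
  have hsβ : HasSize v D c 1 β := ⟨Mβ, by rw [hMβ, pow_one], fun i j => by simpa using hcβ i j⟩
  obtain ⟨B, hB1, hB⟩ := HasSize.exists_one_le hb.le hle hge hv hd D c
  -- The size will be 5 N q^k up to a constant and the order of vanishing at least N², so the
  -- decisive ratio is (B^5 |α|^N)^(N q^k).
  obtain ⟨N, hN1, hNB⟩ : ∃ N : ℕ, 1 ≤ N ∧ B ^ 5 * ‖α‖ ^ N < 1 := by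
    have h1 : Tendsto (fun N : ℕ => B ^ 5 * ‖α‖ ^ N) atTop (𝓝 0) := by
      simpa using (tendsto_pow_atTop_nhds_zero_of_lt_one hα0.le hα1).const_mul (B ^ 5)
    exact ((eventually_ge_atTop 1).and (h1.eventually_lt_const one_pos)).exists
  obtain ⟨P, hP0, hPN, hPc, hPdvd⟩ := exists_pow_dvd_eval (partialProd F q (N ^ 2)) N
  obtain ⟨h, hh⟩ := exists_forall_coeffDegreeLE P
  obtain ⟨m, hm⟩ := exists_not_X_pow_dvd_eval_partialProd (Ω := Ω) hq hb hle hge hθ hroot hP0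
  have hpow : ∀ k : ℕ, k ≤ q ^ (k + 1) := fun k =>
    (Nat.lt_pow_self (by omega)).le.trans (Nat.pow_le_pow_right (by omega) (Nat.le_succ k))
  -- Non-divisibility is known at index m and vanishing at index N²; both persist at the larger
  -- index.
  have hm' : ¬ X ^ q ^ (max m (N ^ 2) + 1) ∣ P.eval (partialProd F q (max m (N ^ 2))) := by
    intro h1
    refine hm ((dvd_sub_right ?_).1 (X_pow_dvd_eval_partialProd_sub hq P (le_max_left m (N ^ 2))))
    refine (pow_dvd_pow _ (Nat.pow_le_pow_right (by omega) ?_)).trans h1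
    exact Nat.succ_le_succ (le_max_left _ _)
  have he : X ^ N ^ 2 ∣ P.eval (partialProd F q (max m (N ^ 2))) := by
    have h1 := X_pow_dvd_eval_partialProd_sub (F := F) hq P (le_max_right m (N ^ 2))
    exact (dvd_sub_left hPdvd).1 ((pow_dvd_pow _ (hpow _)).trans h1)
  obtain ⟨C, hC⟩ := exists_eventually_eval₂_mahlerProd (Ω := Ω) hq hinj hm' he
  have hqk : Tendsto (fun k : ℕ => q ^ k) atTop atTop := tendsto_pow_atTop_atTop_of_one_lt hq
  have hxk : Tendsto (fun k : ℕ => α ^ q ^ k) atTop (𝓝[≠] 0) := by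
    refine tendsto_nhdsWithin_iff.2 ⟨?_, Eventually.of_forall fun k =>
      pow_ne_zero _ (norm_pos_iff.1 hα0)⟩
    exact (tendsto_pow_atTop_nhds_zero_of_norm_lt_one hα1).comp hqk
  set Pr : ℕ → Ω := fun k => ∏ n ∈ Finset.range k, (1 - Θ * α ^ q ^ (n + 1))
  -- Here α^(q^n) ≠ 1/θ enters.
  have hPr0 : ∀ k, Pr k ≠ 0 := fun k =>
    Finset.prod_ne_zero_iff.2 fun n _ => sub_ne_zero.2 (hne n).symm
  obtain ⟨E, hE⟩ : ∃ E, ∀ k, ‖Pr k‖ ≤ E := by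
    have h1 := (multipliable_one_sub_mul_pow_pow (θ := Θ) hq hα1).hasProd.tendsto_prod_nat
    obtain ⟨E, hE⟩ := (Metric.isBounded_range_of_tendsto _ h1).exists_norm_le
    exact ⟨E, fun k => hE _ ⟨k, rfl⟩⟩
  set g : ℕ → Ω := fun k =>
    P.eval₂ (aeval (α ^ q ^ k) : F[X][X] →ₐ[F[X]] Ω).toRingHom (mahlerProd Θ q (α ^ q ^ k))
  -- Since β = Pr k · f(α^(q^k)), the factor Pr k ^ N clears the denominators of f(α^(q^k)) ^ j for
  -- all j ≤ N.
  have hγ : ∀ k, Pr k ^ N * g k = ∑ j ∈ Finset.range (N + 1),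
      aeval (α ^ q ^ k) (P.coeff j) * β ^ j * Pr k ^ (N - j) := fun k => by
    simp only [g]
    rw [eval₂_eq_sum_range' _ (Nat.lt_succ_of_le hPN), Finset.mul_sum]
    refine Finset.sum_congr rfl fun j hj => ?_
    have hjN : j ≤ N := Nat.lt_succ_iff.1 (Finset.mem_range.1 hj)
    have hβk : β = Pr k * mahlerProd Θ q (α ^ q ^ k) := mahlerProd_eq hq hα1 k
    rw [hβk, mul_pow]
    nth_rw 1 [← Nat.sub_add_cancel hjN]
    rw [pow_add]
    change _ * (aeval (α ^ q ^ k) (P.coeff j) * _) = _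
    ring
  have hsize : ∀ k, HasSize v D c (h + 5 * N * q ^ k) (Pr k ^ N * g k) := fun k => by
    rw [hγ k]
    refine HasSize.sum hD _ fun j hj => ?_
    have hjN : j ≤ N := Nat.lt_succ_iff.1 (Finset.mem_range.1 hj)
    refine (((hasSize_aeval hD hsα (hh j) (hPc j) (q ^ k)).mul (hsβ.pow hD j)).mul
      ((hasSize_prod hq hD hsα k).pow hD (N - j))).mono (by omega) ?_
    -- The three factors have sizes h + N q^k, j ≤ N and (N - j) · 3 q^k, in all at most h + 5 N
    -- q^k.
    have h1 : 1 ≤ q ^ k := Nat.one_le_pow _ _ (by omega)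
    have h2 : (N - j) * (3 * q ^ k) ≤ N * (3 * q ^ k) :=
      Nat.mul_le_mul_right _ (Nat.sub_le _ _)
    nlinarith
  have hbound : ∀ᶠ k in atTop,
      1 ≤ B ^ (h + 1) * E ^ N * C * ((B ^ 5 * ‖α‖ ^ N) ^ N) ^ q ^ k := by
    filter_upwards [hxk.eventually hC] with k hk
    have h1 := hB _ _ (mul_ne_zero (pow_ne_zero N (hPr0 k)) hk.1) hD0 (hsize k)
    have hE0 : 0 ≤ E := (norm_nonneg _).trans (hE 0)
    refine h1.trans ?_
    rw [norm_mul, norm_pow]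
    calc B ^ (h + 5 * N * q ^ k + 1) * (‖Pr k‖ ^ N * ‖g k‖)
        ≤ B ^ (h + 5 * N * q ^ k + 1) * (E ^ N * (C * ‖α ^ q ^ k‖ ^ N ^ 2)) := by
          gcongr
          · exact hE k
          · exact hk.2
      _ = _ := by
          rw [norm_pow, mul_pow, mul_pow]
          simp only [← pow_mul]
          rw [show h + 5 * N * q ^ k + 1 = (h + 1) + 5 * N * q ^ k by ring, pow_add,
            show q ^ k * N ^ 2 = N * N * q ^ k by ring]
          ring
  have hlim : Tendsto (fun k : ℕ => B ^ (h + 1) * E ^ N * C * ((B ^ 5 * ‖α‖ ^ N) ^ N) ^ q ^ k)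
      atTop (𝓝 0) := by
    have h1 := (tendsto_pow_atTop_nhds_zero_of_lt_one
      (r := (B ^ 5 * ‖α‖ ^ N) ^ N) (by positivity)
      (pow_lt_one₀ (by positivity) hNB (by omega))).comp hqk
    simpa using h1.const_mul (B ^ (h + 1) * E ^ N * C)
  exact absurd (ge_of_tendsto hlim hbound) (by norm_num)

end Mahler

end Carlitz

namespace Carlitz

open Polynomial

/-! ### Application to C and the Carlitz period -/

section CInfty

variable (F : Type*) [Field F] [Finite F]

theorem norm_algebraMap_CInfty {a : RatFunc F} (ha : a ≠ 0) :
    ‖algebraMap (RatFunc F) (CInfty F) a‖ = (Nat.card F : ℝ) ^ a.intDegree := by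
  change ‖((algebraMap (KInfty F) (KInftyAlg F) (algebraMap (RatFunc F) (KInfty F) a) :
    KInftyAlg F) : CInfty F)‖ = _
  rw [UniformSpace.Completion.norm_coe, norm_algebraMap', norm_algebraMap F ha]

theorem theta_ne_zero : theta F ≠ 0 := by
  rw [theta, Ne, map_eq_zero]
  exact RatFunc.X_ne_zero

/-- Supplies the zeros of f in C; the root is already found in the algebraic closure of K_∞. -/
theorem exists_theta_mul_pow_eq_one {k : ℕ} (hk : 0 < k) : ∃ x : CInfty F, theta F * x ^ k = 1 := by
  obtain ⟨z, hz⟩ := IsAlgClosed.exists_pow_nat_eq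
    (algebraMap (KInfty F) (KInftyAlg F) (algebraMap (RatFunc F) (KInfty F) RatFunc.X)) hk
  refine ⟨(algebraMap (KInftyAlg F) (CInfty F) z)⁻¹, ?_⟩
  rw [inv_pow, ← map_pow, hz]
  exact mul_inv_cancel₀ (theta_ne_zero F)

theorem multipliable_fDeFactor {α : CInfty F} (hα : ‖α‖ < 1) : Multipliable (fDeFactor F α) :=
  multipliable_one_sub_mul_pow_pow (Finite.one_lt_card (α := F)) hα

theorem transcendental_fDe {α : CInfty F} (hα : IsAlgebraic (RatFunc F) α) (hα0 : 0 < ‖α‖)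
    (hα1 : ‖α‖ < 1) (hne : ∀ n : ℕ, 1 ≤ n → α ^ (Nat.card F ^ n) ≠ (theta F)⁻¹) :
    Transcendental (RatFunc F) (fDe F α) := by
  let _ : Algebra F[X] (CInfty F) :=
    ((algebraMap (RatFunc F) (CInfty F)).comp (algebraMap F[X] (RatFunc F))).toAlgebra
  have : @IsScalarTower F[X] (RatFunc F) (CInfty F)
      Algebra.toSMul Algebra.toSMul Algebra.toSMul := IsScalarTower.of_algebraMap_eq fun _ => rfl
  have hθ : algebraMap F[X] (CInfty F) X = theta F := by
    rw [IsScalarTower.algebraMap_apply F[X] (RatFunc F), RatFunc.algebraMap_X, theta]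
  have hq : 2 ≤ Nat.card F := Finite.one_lt_card (α := F)
  have key := transcendental_mahlerProd (RatFunc F) (F := F) (Ω := CInfty F) (q := Nat.card F)
    (b := Nat.card F) hq (by exact_mod_cast hq) (fun a ha => by
      rw [IsScalarTower.algebraMap_apply F[X] (RatFunc F), norm_algebraMap_CInfty F
        (by simpa using ha), RatFunc.intDegree_polynomial, zpow_natCast])
    (fun n => by
      rw [hθ]
      exact exists_theta_mul_pow_eq_one F (by positivity)) hα hα0 hα1 (fun n h => by
      rw [hθ] at h
      exact hne (n + 1) (by omega) (eq_inv_of_mul_eq_one_right h))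
  rwa [hθ] at key

theorem periodFactor_eq_inv_fDeFactor (i : ℕ) :
    periodFactor F i = (fDeFactor F (theta F)⁻¹ i)⁻¹ := by
  rw [periodFactor, fDeFactor, inv_pow, zpow_sub₀ (theta_ne_zero F), zpow_one, div_eq_mul_inv]
  norm_cast

theorem transcendental_fDe_inv_theta : ‖(theta F)⁻¹‖ < 1 ∧
    Transcendental (RatFunc F) (fDe F (theta F)⁻¹) := by
  have hq : 2 ≤ Nat.card F := Finite.one_lt_card (α := F)
  have h0 := theta_ne_zero F
  have h1 : ‖(theta F)⁻¹‖ < 1 := by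
    rw [norm_inv, norm_theta]
    exact inv_lt_one_of_one_lt₀ (by exact_mod_cast hq)
  refine ⟨h1, transcendental_fDe F ?_ (norm_pos_iff.2 (inv_ne_zero h0)) h1 fun n hn h => ?_⟩
  · exact IsAlgebraic.inv (isAlgebraic_algebraMap RatFunc.X)
  -- For α = 1/θ the excluded equality fails by absolute values: |α|^(q^n) < |α|.
  · have h2 := congrArg norm h
    rw [norm_pow] at h2
    have h3 : 1 < Nat.card F ^ n := Nat.one_lt_pow (by omega) hq
    have h4 := pow_lt_pow_right_of_lt_one₀ (norm_pos_iff.2 (inv_ne_zero h0)) h1 h3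
    rw [h2, pow_one] at h4
    exact lt_irrefl _ h4

theorem fDe_inv_theta_ne_zero : fDe F (theta F)⁻¹ ≠ 0 := fun h =>
  (transcendental_fDe_inv_theta F).2 (h ▸ isAlgebraic_zero)

/-- Inverting a convergent product requires a nonzero limit, which here comes from transcendence. -/
theorem hasProd_periodFactor : HasProd (periodFactor F) (fDe F (theta F)⁻¹)⁻¹ := by
  have h := (multipliable_fDeFactor F (transcendental_fDe_inv_theta F).1).hasProd.inv₀
    (fDe_inv_theta_ne_zero F)
  exact (funext (periodFactor_eq_inv_fDeFactor F)) ▸ h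

theorem transcendental_period {l : CInfty F} (hl : l ^ (Nat.card F - 1) = -theta F) :
    Transcendental (RatFunc F) (period F l) := by
  intro h
  have hq : 0 < Nat.card F - 1 := Nat.sub_pos_of_lt (Finite.one_lt_card (α := F))
  have h0 := theta_ne_zero F
  have hl0 : l ≠ 0 := by
    rintro rfl
    rw [zero_pow hq.ne', eq_comm, neg_eq_zero] at hl
    exact h0 hl
  have hθ : IsAlgebraic (RatFunc F) (theta F) := isAlgebraic_algebraMap RatFunc.X
  have hla : IsAlgebraic (RatFunc F) l := IsAlgebraic.of_pow hq (hl ▸ hθ.neg)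
  have hp : fDe F (theta F)⁻¹ = theta F * l * (period F l)⁻¹ := by
    have := fDe_inv_theta_ne_zero F
    rw [period, (hasProd_periodFactor F).tprod_eq]
    field_simp
  exact (transcendental_fDe_inv_theta F).2 (hp ▸ (hθ.mul hla).mul h.inv)

end CInfty

end Carlitz

theorem mainTheorem4 (F : Type*) [Field F] [Finite F] :
    (∀ α : Carlitz.CInfty F, IsAlgebraic (RatFunc F) α → 0 < ‖α‖ → ‖α‖ < 1 →
      (∀ n : ℕ, 1 ≤ n → α ^ (Nat.card F ^ n) ≠ (Carlitz.theta F)⁻¹) →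
      Multipliable (Carlitz.fDeFactor F α) ∧ Transcendental (RatFunc F) (Carlitz.fDe F α)) ∧
    (∀ l : Carlitz.CInfty F, l ^ (Nat.card F - 1) = -Carlitz.theta F →
      Multipliable (Carlitz.periodFactor F) ∧
        Transcendental (RatFunc F) (Carlitz.period F l)) :=
  ⟨fun _ hα hα0 hα1 hne =>
    ⟨Carlitz.multipliable_fDeFactor F hα1, Carlitz.transcendental_fDe F hα hα0 hα1 hne⟩,
  fun _ hl =>
    ⟨(Carlitz.hasProd_periodFactor F).multipliable, Carlitz.transcendental_period F hl⟩⟩
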